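/- Let $\operatorname{erf}(x)=\frac1{\sqrt\pi}\int_{-x}^{x}e^{-t^2}\,dt$. For integers $d,k\ge 1$ let $x=(x_1,\dots,x_k)$ with $x_1,\dots,x_k$ i.i.d. standard Gaussian vectors in $\mathbb R^d$, and for $w_0\in\mathbb R^d$ define the weight-sharing predictor $$p^{(1,k)}_{w_0}(x)=\operatorname{erf}(w_0^\top x_1)+\prod_{l=1}^{k}\operatorname{erf}(w_0^\top x_l).$$ For a target vector $u_0\in\mathbb R^d$ let $$F^{(1,k)}(w_0)=\mathbb E_x\left[\tfrac12\left(p^{(1,k)}_{w_0}(x)-p^{(1,k)}_{u_0}(x)\right)^2\right].$$ There are absolute constants $\eta_0>0$ and $C>0$ such that the following holds for every constant learning rate $\eta\in(0,\eta_0]$, all $d,k\ge1$ and all $u_0\in\mathbb R^d$ with $\|u_0\|^2=\frac{12}{\pi^2}k^2$. Let $(w_0^{(t)})_{t\ge0}$ be a run of gradient descent on $F^{(1,k)}$, i.e. $w_0^{(t+1)}=w_0^{(t)}-\eta\nabla F^{(1,k)}(w_0^{(t)})$ for all $t$, or a run of projected gradient descent, i.e. $w_0^{(t+1)}$ is the Euclidean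 projection of $w_0^{(t)}-\eta\nabla F^{(1,k)}(w_0^{(t)})$ onto the ball $\{v:\|v\|\le\|u_0\|\}$ for all $t$. Assume that $u_0^\top w_0^{(0)}>0$ and that $\|w_0^{(t)}\|\le\|u_0\|$ for all $t$ (for projected gradient descent this only concerns $t=0$). Let $\alpha^{(t)}$ be the angle between $u_0$ and $w_0^{(t)}$. Then 1. $\alpha^{(t+1)}\le\alpha^{(t)}$ for all $t\ge 0$; 2. for every $\epsilon>0$ there is an integer $T\ge 0$ with $T\le \frac{C}{\eta}\left(\frac k\epsilon\right)^3$ and $\alpha^{(T)}<\epsilon$. In particular, for fixed $\eta$, $T=O\left((k/\epsilon)^3\right)$. -/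

import Mathlib

open MeasureTheory ProbabilityTheory
open scoped Gradient RealInnerProductSpace

namespace WeightSharing

noncomputable section

/-- The error function `erf x = π^{-1/2} ∫_{-x}^{x} exp(-t²) dt`. -/
def erf (x : ℝ) : ℝ := 1 / √Real.pi * ∫ t in (-x)..x, Real.exp (-t ^ 2)

/-- The law of the input `x = (x₁, …, x_k)`: the `x_l` are i.i.d. standard Gaussian
vectors in `ℝ^d`. -/
def inputLaw (d k : ℕ) : Measure (Fin k → EuclideanSpace ℝ (Fin d)) :=
  Measure.pi fun _ => stdGaussian (EuclideanSpace ℝ (Fin d))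

/-- The predictor `p_w^{(k)}(x) = ∏_l σ(w_lᵀ x_l)`, with `σ = erf`. -/
def prodPredictor {d k : ℕ} (w x : Fin k → EuclideanSpace ℝ (Fin d)) : ℝ :=
  ∏ l, erf ⟪w l, x l⟫

/-- The predictor `p_w^{(1,k)}(x) = σ(w₁ᵀ x₁) + ∏_l σ(w_lᵀ x_l)`; the first of the `k`
instances has index `0 : Fin k`. -/
def sumPredictor {d k : ℕ} [NeZero k] (w x : Fin k → EuclideanSpace ℝ (Fin d)) : ℝ :=
  erf ⟪w 0, x 0⟫ + prodPredictor w x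

/-- The weight-sharing predictor `p_{w₀}^{(1,k)}`, in which `w_l = w₀` for all `l`. -/
def sharedPredictor {d : ℕ} (k : ℕ) [NeZero k] (w₀ : EuclideanSpace ℝ (Fin d))
    (x : Fin k → EuclideanSpace ℝ (Fin d)) : ℝ :=
  sumPredictor (fun _ => w₀) x

/-- The expected squared loss `F^{(1,k)}(w₀) = E_x[½ (p_{w₀}^{(1,k)}(x) - p_{u₀}^{(1,k)}(x))²]`
of the weight-sharing architecture, with target `p_{u₀}^{(1,k)}`. -/
def objective {d : ℕ} (k : ℕ) [NeZero k] (u₀ w₀ : EuclideanSpace ℝ (Fin d)) : ℝ :=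
  ∫ x, 1 / 2 * (sharedPredictor k w₀ x - sharedPredictor k u₀ x) ^ 2 ∂(inputLaw d k)

/-- One gradient step for `F^{(1,k)}` with learning rate `η`. -/
def gradStep {d : ℕ} (k : ℕ) [NeZero k] (η : ℝ) (u₀ w₀ : EuclideanSpace ℝ (Fin d)) :
    EuclideanSpace ℝ (Fin d) :=
  w₀ - η • ∇ (objective k u₀) w₀

/-- The metric projection onto the closed ball of radius `r` around the origin. -/
def projBall {d : ℕ} (r : ℝ) (v : EuclideanSpace ℝ (Fin d)) : EuclideanSpace ℝ (Fin d) :=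
  if ‖v‖ ≤ r then v else (r / ‖v‖) • v

/-- `w` is a run of gradient descent on `F^{(1,k)}` with constant learning rate `η`. -/
def IsGD {d : ℕ} (k : ℕ) [NeZero k] (η : ℝ) (u₀ : EuclideanSpace ℝ (Fin d))
    (w : ℕ → EuclideanSpace ℝ (Fin d)) : Prop :=
  ∀ t, w (t + 1) = gradStep k η u₀ (w t)

/-- `w` is a run of gradient descent on `F^{(1,k)}` with constant learning rate `η`, in which
every step is followed by the projection onto the ball of radius `‖u₀‖`. -/
def IsProjectedGD {d : ℕ} (k : ℕ) [NeZero k] (η : ℝ) (u₀ : EuclideanSpace ℝ (Fin d))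
    (w : ℕ → EuclideanSpace ℝ (Fin d)) : Prop :=
  ∀ t, w (t + 1) = projBall ‖u₀‖ (gradStep k η u₀ (w t))

end

end WeightSharing

namespace WeightSharing

/-! Independence of the `x_l` and oddness of erf turn the loss into a function of correlations `z =
E[erf(wᵀx) erf(uᵀx)]`, entering through the link `c z + z ^ k` (`objective_eq`). Each correlation is
`2/π` times the arcsine of an explicit ratio (`integral_erf_mul_erf`). The gradient at `w` therefore
lies in the span of `w` and `u`, and a step has the form `a • w + b • u` (`exists_gradStep_eq`). The
learning rate can be chosen independently of `k`: the dangerous factor `k z ^ (k - 1)` is at most `1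
/ (1 - z)`, and its growth near `z = 1` is compensated by the denominators of the gradient
(`shrink_coeff_le`). This keeps `a` in `(0, 1]`, while `b` is at least `η / (5 k²)` because all
norms are `O(k)` (`rate_le`).

Now write `w = p • u + v` with `v ⊥ u`. A step multiplies `v` by `a` and sends `p` to `a p + b`;
projection rescales both equally. With `κ = η / (5 k²)`, the inequalities `b ≥ κ a` and `‖v‖ ≤ ‖w‖ ≤
‖u‖` make the cotangent `p‖u‖ / ‖v‖` of the angle grow by at least `κ` per step
(`exists_orthogonal_decomposition`). Hence about `5 k² / (η ε)` steps suffice, which is within the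
cubic bound when `ε < 2`; for larger `ε` the initial angle, being acute, is already small enough. -/

/-! ### The error function and one-dimensional Gaussian integrals. -/

theorem continuous_exp_neg_sq : Continuous fun t : ℝ => Real.exp (-t ^ 2) := by fun_prop

theorem erf_eq (x : ℝ) : erf x = 2 / √Real.pi * ∫ t in (0 : ℝ)..x, Real.exp (-t ^ 2) := by
  have hi : ∀ a b : ℝ, IntervalIntegrable (fun t : ℝ => Real.exp (-t ^ 2)) volume a b :=
    fun a b => continuous_exp_neg_sq.intervalIntegrable a b
  have h1 := intervalIntegral.integral_add_adjacent_intervals (hi (-x) 0) (hi 0 x)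
  have h2 := intervalIntegral.integral_comp_neg (a := 0) (b := x) fun t : ℝ => Real.exp (-t ^ 2)
  simp only [neg_sq, neg_zero] at h2
  rw [erf, ← h1, ← h2]
  ring

theorem erf_zero : erf 0 = 0 := by simp [erf_eq]

theorem erf_neg (x : ℝ) : erf (-x) = -erf x := by
  unfold erf
  rw [intervalIntegral.integral_symm, neg_neg, mul_neg]

theorem hasDerivAt_erf (x : ℝ) :
    HasDerivAt erf (2 / √Real.pi * Real.exp (-x ^ 2)) x := by
  have h : erf = fun x => 2 / √Real.pi * ∫ t in (0 : ℝ)..x, Real.exp (-t ^ 2) := funext erf_eq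
  rw [h]
  exact (intervalIntegral.integral_hasDerivAt_right
    (continuous_exp_neg_sq.intervalIntegrable _ _)
    (continuous_exp_neg_sq.stronglyMeasurableAtFilter _ _)
    continuous_exp_neg_sq.continuousAt).const_mul _

theorem continuous_erf : Continuous erf :=
  continuous_iff_continuousAt.2 fun x => (hasDerivAt_erf x).continuousAt

@[fun_prop]
theorem measurable_erf : Measurable erf := continuous_erf.measurable

theorem abs_erf_le_one (x : ℝ) : |erf x| ≤ 1 := by
  have hint : Integrable fun t : ℝ => Real.exp (-t ^ 2) := by
    simpa using integrable_exp_neg_mul_sq one_pos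
  have htot : ∫ t : ℝ, Real.exp (-t ^ 2) = √Real.pi := by
    simpa using integral_gaussian 1
  have h1 : |∫ t in (-x)..x, Real.exp (-t ^ 2)| ≤ √Real.pi := by
    rw [← htot]
    refine (intervalIntegral.norm_integral_le_integral_norm_uIoc (f := fun t : ℝ => Real.exp (-t ^ 2))
      (a := -x) (b := x)).trans ?_
    simp only [Real.norm_eq_abs, Real.abs_exp]
    exact setIntegral_le_integral hint (Filter.Eventually.of_forall fun t => (Real.exp_pos _).le)
  have hpi : 0 < √Real.pi := Real.sqrt_pos.2 Real.pi_pos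
  rw [erf, abs_mul, abs_of_pos (by positivity), one_div, inv_mul_le_iff₀ hpi, mul_one]
  exact h1

/-- Integration against the standard Gaussian law in terms of Lebesgue measure. -/
theorem integral_gaussianReal_zero_one (f : ℝ → ℝ) :
    ∫ y, f y ∂gaussianReal 0 1 =
      (√(2 * Real.pi))⁻¹ * ∫ y, f y * Real.exp (-(1 / 2) * y ^ 2) := by
  rw [integral_gaussianReal_eq_integral_smul one_ne_zero, ← integral_const_mul]
  refine integral_congr_ae (Filter.Eventually.of_forall fun y => ?_)
  simp only [gaussianPDFReal, NNReal.coe_one, smul_eq_mul, sub_zero, mul_one]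
  rw [show -y ^ 2 / 2 = -(1 / 2) * y ^ 2 by ring]
  ring

/-- Complete the square in `y`. Up to the factor `2/√π` this is the `α`-derivative of the smoothed
error function. -/
theorem integral_exp_neg_affine_sq (α β : ℝ) :
    ∫ y, Real.exp (-(α + β * y) ^ 2) ∂gaussianReal 0 1 =
      Real.exp (-(α / √(1 + 2 * β ^ 2)) ^ 2) / √(1 + 2 * β ^ 2) := by
  have hB : 0 < 1 + 2 * β ^ 2 := by positivity
  have hpi := Real.pi_pos
  rw [integral_gaussianReal_zero_one]
  have h1 : ∀ y : ℝ, Real.exp (-(α + β * y) ^ 2) * Real.exp (-(1 / 2) * y ^ 2) =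
      Real.exp (-(α / √(1 + 2 * β ^ 2)) ^ 2) *
        Real.exp (-((1 + 2 * β ^ 2) / 2) * (y + 2 * α * β / (1 + 2 * β ^ 2)) ^ 2) := by
    intro y
    rw [← Real.exp_add, ← Real.exp_add, div_pow, Real.sq_sqrt hB.le]
    congr 1
    field_simp
    ring
  simp_rw [h1]
  rw [integral_const_mul, integral_add_right_eq_self
    (fun y : ℝ => Real.exp (-((1 + 2 * β ^ 2) / 2) * y ^ 2)), integral_gaussian,
    show Real.pi / ((1 + 2 * β ^ 2) / 2) = 2 * Real.pi / (1 + 2 * β ^ 2) by field_simp,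
    Real.sqrt_div (by positivity)]
  have : √(2 * Real.pi) ≠ 0 := by positivity
  field_simp

theorem integrable_of_abs_le {Ω : Type*} [MeasurableSpace Ω] {μ : Measure Ω} [IsFiniteMeasure μ]
    {f : Ω → ℝ} (hf : Measurable f) (c : ℝ) (hc : ∀ x, |f x| ≤ c) : Integrable f μ :=
  Integrable.of_bound hf.aestronglyMeasurable c (Filter.Eventually.of_forall hc)

/-- Gaussian smoothing of the error function only rescales it. -/
theorem integral_erf_affine (α β : ℝ) :
    ∫ y, erf (α + β * y) ∂gaussianReal 0 1 = erf (α / √(1 + 2 * β ^ 2)) := by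
  have hpi := Real.pi_pos
  -- Both sides have the same derivative in `α`, so it suffices to compare them at `α = 0`, where
  -- both vanish because erf is odd.
  have hd : ∀ a : ℝ, HasDerivAt
      (fun a => ∫ y, erf (a + β * y) ∂gaussianReal 0 1 - erf (a / √(1 + 2 * β ^ 2))) 0 a := by
    intro a
    have h1 := (hasDerivAt_integral_of_dominated_loc_of_deriv_le (μ := gaussianReal 0 1)
      (F := fun a y => erf (a + β * y)) (x₀ := a) (s := Set.univ)
      (F' := fun a y => 2 / √Real.pi * Real.exp (-(a + β * y) ^ 2))
      (bound := fun _ => 2 / √Real.pi) Filter.univ_mem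
      (Filter.Eventually.of_forall fun a => (by fun_prop : Measurable _).aestronglyMeasurable)
      (integrable_of_abs_le (by fun_prop) 1 fun y => abs_erf_le_one _)
      (by fun_prop : Measurable _).aestronglyMeasurable
      (Filter.Eventually.of_forall fun y a _ => by
        rw [Real.norm_eq_abs, abs_of_pos (by positivity)]
        exact mul_le_of_le_one_right (by positivity) (Real.exp_le_one_iff.2 (by
          have := sq_nonneg (a + β * y); linarith)))
      (integrable_const _)
      (Filter.Eventually.of_forall fun y a _ => by
        simpa [Function.comp_def] using! (hasDerivAt_erf (a + β * y)).comp a ((hasDerivAt_id a).add_const (β * y)))).2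
    have h2 := (hasDerivAt_erf (a / √(1 + 2 * β ^ 2))).comp a
      ((hasDerivAt_id a).div_const (√(1 + 2 * β ^ 2)))
    refine (h1.sub h2).congr_deriv ?_
    rw [integral_const_mul, integral_exp_neg_affine_sq]
    ring
  have hconst := is_const_of_deriv_eq_zero (fun a => (hd a).differentiableAt)
    (fun a => (hd a).deriv) α 0
  have hodd : ∫ y, erf (β * y) ∂gaussianReal 0 1 = 0 := by
    have h1 : ∫ y, erf (β * y) * Real.exp (-(1 / 2) * y ^ 2) = 0 := by
      have h2 := integral_neg_eq_self (fun y : ℝ => erf (β * y) * Real.exp (-(1 / 2) * y ^ 2)) volume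
      simp only [mul_neg, erf_neg, neg_mul, neg_sq] at h2
      rw [integral_neg] at h2
      simp only [neg_mul]
      linarith
    rw [integral_gaussianReal_zero_one, h1, mul_zero]
  simp only [zero_add, zero_div, erf_zero, sub_zero, hodd] at hconst
  linarith

/-- Integration by parts: the derivative of `erf (a x) exp (-c x²)` has integral zero over the line,
which leaves a pure Gaussian integral. -/
theorem integral_erf_mul_mul_exp (a c : ℝ) (hc : 0 < c) :
    ∫ x, erf (a * x) * (x * Real.exp (-c * x ^ 2)) = a / (c * √(a ^ 2 + c)) := by
  have hpi := Real.pi_pos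
  have hac : 0 < a ^ 2 + c := by positivity
  have hbdd : ∀ {f : ℝ → ℝ}, Integrable f → Integrable fun x => erf (a * x) * f x := fun hf =>
    hf.bdd_mul (c := 1) (by fun_prop : Measurable _).aestronglyMeasurable
      (Filter.Eventually.of_forall fun x => abs_erf_le_one _)
  have i1 := hbdd (integrable_exp_neg_mul_sq hc)
  have i2 := hbdd (integrable_mul_exp_neg_mul_sq hc)
  have i3 := integrable_exp_neg_mul_sq hac
  have hd : ∀ x : ℝ, HasDerivAt (fun x => erf (a * x) * Real.exp (-c * x ^ 2))
      (2 * a / √Real.pi * Real.exp (-(a ^ 2 + c) * x ^ 2) -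
        2 * c * (erf (a * x) * (x * Real.exp (-c * x ^ 2)))) x := by
    intro x
    have h1 := (hasDerivAt_erf (a * x)).comp x ((hasDerivAt_id x).const_mul a)
    have h2 := (((hasDerivAt_id x).pow 2).const_mul (-c)).exp
    refine (h1.mul h2).congr_deriv ?_
    rw [show -(a ^ 2 + c) * x ^ 2 = -(a * x) ^ 2 + -c * x ^ 2 by ring, Real.exp_add]
    simp
    ring
  have h := integral_eq_zero_of_hasDerivAt_of_integrable hd
    ((i3.const_mul _).sub (i2.const_mul _)) i1
  rw [integral_sub (i3.const_mul _) (i2.const_mul _), integral_const_mul, integral_const_mul,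
    integral_gaussian, Real.sqrt_div hpi.le] at h
  have hs : √Real.pi ≠ 0 := by positivity
  have hs2 : √(a ^ 2 + c) ≠ 0 := by positivity
  field_simp at h ⊢
  linarith

/-- The summands `1` make Cauchy–Schwarz strict, so the arcsine is always evaluated where it is
differentiable, even for parallel vectors. -/
theorem abs_ratio_lt_one {a b p : ℝ} (ha : 0 ≤ a) (hb : 0 ≤ b) (h : p ^ 2 ≤ a * b) :
    |2 * p / (√(1 + 2 * a) * √(1 + 2 * b))| < 1 := by
  rw [← sq_lt_one_iff_abs_lt_one, div_pow, mul_pow, mul_pow, Real.sq_sqrt (by positivity),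
    Real.sq_sqrt (by positivity), div_lt_one (by positivity)]
  nlinarith

theorem sqrt_one_sub_ratio_sq {a b p : ℝ} (ha : 0 ≤ a) (hb : 0 ≤ b) :
    √(1 - (2 * p / (√(1 + 2 * a) * √(1 + 2 * b))) ^ 2) =
      √((1 + 2 * a) * (1 + 2 * b) - 4 * p ^ 2) / (√(1 + 2 * a) * √(1 + 2 * b)) := by
  rw [← Real.sqrt_mul (by positivity), div_pow, Real.sq_sqrt (by positivity),
    ← Real.sqrt_div' _ (by positivity)]
  congr 1
  field_simp
  ring

theorem hasDerivAt_inv_sqrt_one_add {b : ℝ} (hb : 0 ≤ b) :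
    HasDerivAt (fun b => (√(1 + 2 * b))⁻¹) (-1 / ((1 + 2 * b) * √(1 + 2 * b))) b := by
  have h := ((((hasDerivAt_id b).const_mul 2).const_add 1).sqrt (by simp; positivity)).inv
    (by simp; positivity)
  refine h.congr_deriv ?_
  simp
  rw [Real.sq_sqrt (by positivity)]
  field_simp

/-- The correlation of two linear error functions of a standard Gaussian variable. -/
theorem integral_erf_mul_erf_real (a b : ℝ) :
    ∫ x, erf (a * x) * erf (b * x) ∂gaussianReal 0 1 =
      2 / Real.pi * Real.arcsin (2 * (a * b) / (√(1 + 2 * a ^ 2) * √(1 + 2 * b ^ 2))) := by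
  have hpi := Real.pi_pos
  -- Differentiation in `b` removes one erf; both sides vanish at `b = 0`.
  have hd : ∀ b : ℝ, HasDerivAt
      (fun b => ∫ x, erf (a * x) * erf (b * x) ∂gaussianReal 0 1 -
        2 / Real.pi * Real.arcsin (2 * (a * b) / (√(1 + 2 * a ^ 2) * √(1 + 2 * b ^ 2)))) 0 b := by
    intro b
    have hA : 0 < 1 + 2 * a ^ 2 := by positivity
    have hB : 0 < 1 + 2 * b ^ 2 := by positivity
    have hD : 0 < 1 + 2 * a ^ 2 + 2 * b ^ 2 := by positivity
    have h1 := (hasDerivAt_integral_of_dominated_loc_of_deriv_le (μ := gaussianReal 0 1)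
      (F := fun b x => erf (a * x) * erf (b * x)) (x₀ := b) (s := Set.univ)
      (F' := fun b x => erf (a * x) * (2 / √Real.pi * Real.exp (-(b * x) ^ 2) * x))
      (bound := fun x => 2 / √Real.pi * |x|) Filter.univ_mem
      (Filter.Eventually.of_forall fun a => (by fun_prop : Measurable _).aestronglyMeasurable)
      (integrable_of_abs_le (by fun_prop) 1 fun y => by
        rw [abs_mul]
        exact mul_le_one₀ (abs_erf_le_one _) (abs_nonneg _) (abs_erf_le_one _))
      (by fun_prop : Measurable _).aestronglyMeasurable
      (Filter.Eventually.of_forall fun x b _ => by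
        have he : Real.exp (-(b * x) ^ 2) ≤ 1 := Real.exp_le_one_iff.2 (by
          have := sq_nonneg (b * x); linarith)
        have hp : 0 < 2 / √Real.pi * Real.exp (-(b * x) ^ 2) := by positivity
        rw [Real.norm_eq_abs, abs_mul, abs_mul, abs_of_pos hp]
        refine (mul_le_of_le_one_left (by positivity) (abs_erf_le_one _)).trans ?_
        gcongr
        exact mul_le_of_le_one_right (by positivity) he)
      (((memLp_id_gaussianReal 1).integrable le_rfl).abs.const_mul _)
      (Filter.Eventually.of_forall fun x b _ => by
        simpa [Function.comp_def] using! ((hasDerivAt_erf (b * x)).comp b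
          ((hasDerivAt_id b).mul_const x)).const_mul (erf (a * x)))).2
    have hlt := abs_lt.1 (abs_ratio_lt_one (p := a * b) (sq_nonneg a) (sq_nonneg b)
      (by rw [mul_pow]))
    have hs : HasDerivAt (fun b => 2 * (a * b) / (√(1 + 2 * a ^ 2) * √(1 + 2 * b ^ 2)))
        (2 * a / (√(1 + 2 * a ^ 2) * ((1 + 2 * b ^ 2) * √(1 + 2 * b ^ 2)))) b := by
      have h3 := HasDerivAt.comp (h := fun b : ℝ => b ^ 2) b
        (hasDerivAt_inv_sqrt_one_add (sq_nonneg b)) (hasDerivAt_pow 2 b)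
      have h4 := ((hasDerivAt_id b).const_mul (2 * a / √(1 + 2 * a ^ 2))).mul h3
      refine (h4.congr_deriv ?_).congr_of_eventuallyEq
        (Filter.Eventually.of_forall fun y => ?_)
      · simp
        field_simp
        ring
      · simp
        field_simp
    have h2 := (HasDerivAt.comp b (Real.hasDerivAt_arcsin hlt.1.ne' hlt.2.ne) hs).const_mul
      (2 / Real.pi)
    refine (h1.sub h2).congr_deriv ?_
    have h5 : ∫ x, erf (a * x) * (2 / √Real.pi * Real.exp (-(b * x) ^ 2) * x) ∂gaussianReal 0 1 =
        4 * a / (Real.pi * (1 + 2 * b ^ 2) * √(1 + 2 * a ^ 2 + 2 * b ^ 2)) := by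
      rw [integral_gaussianReal_zero_one]
      have h6 : ∀ x : ℝ, erf (a * x) * (2 / √Real.pi * Real.exp (-(b * x) ^ 2) * x) *
          Real.exp (-(1 / 2) * x ^ 2) = 2 / √Real.pi * (erf (a * x) *
            (x * Real.exp (-((1 + 2 * b ^ 2) / 2) * x ^ 2))) := by
        intro x
        rw [show -((1 + 2 * b ^ 2) / 2) * x ^ 2 = -(b * x) ^ 2 + -(1 / 2) * x ^ 2 by ring,
          Real.exp_add]
        ring
      simp_rw [h6]
      rw [integral_const_mul, integral_erf_mul_mul_exp _ _ (by positivity),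
        show a ^ 2 + (1 + 2 * b ^ 2) / 2 = (1 + 2 * a ^ 2 + 2 * b ^ 2) / 2 by ring,
        Real.sqrt_div hD.le, Real.sqrt_mul (by norm_num)]
      have e1 : √Real.pi * √Real.pi = Real.pi := Real.mul_self_sqrt hpi.le
      have e0 : √Real.pi ≠ 0 := by positivity
      have e2 : √(2 : ℝ) ≠ 0 := by positivity
      generalize √Real.pi = s at e0 e1
      rw [← e1]
      field_simp
      ring
    rw [h5, sqrt_one_sub_ratio_sq (sq_nonneg a) (sq_nonneg b),
      show (1 + 2 * a ^ 2) * (1 + 2 * b ^ 2) - 4 * (a * b) ^ 2 = 1 + 2 * a ^ 2 + 2 * b ^ 2 by ring]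
    field_simp
    ring
  have hconst := is_const_of_deriv_eq_zero (fun a => (hd a).differentiableAt)
    (fun a => (hd a).deriv) b 0
  simp only [mul_zero, zero_mul, zero_div, Real.arcsin_zero, sub_zero, erf_zero,
    integral_zero] at hconst
  linarith

/-! ### Standard Gaussian vectors and the correlation of two linear error functions. -/

section Gaussian

variable {E : Type*} [NormedAddCommGroup E] [InnerProductSpace ℝ E] [FiniteDimensional ℝ E]
  [MeasurableSpace E] [BorelSpace E]

theorem stdGaussian_map_inner (w : E) :
    (stdGaussian E).map (fun x => ⟪w, x⟫) = (gaussianReal 0 1).map (fun y => ‖w‖ * y) := by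
  have h := IsGaussian.map_eq_gaussianReal (μ := stdGaussian E) (innerSL ℝ w)
  rw [integral_strongDual_stdGaussian, variance_dual_stdGaussian, innerSL_apply_norm] at h
  rw [gaussianReal_map_const_mul]
  convert h using 2
  · simp
  · rw [mul_zero]
  · rw [mul_one]
    exact NNReal.eq (Real.coe_toNNReal _ (sq_nonneg _)).symm

/-- Jointly Gaussian variables are independent once uncorrelated, and the covariance here is `⟪w,
v⟫`. -/
theorem indepFun_inner_stdGaussian {w v : E} (h : ⟪w, v⟫ = 0) :
    IndepFun (fun x => ⟪w, x⟫) (fun x => ⟪v, x⟫) (stdGaussian E) := by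
  refine HasGaussianLaw.indepFun_of_covariance_eq_zero ⟨?_⟩ ?_
  · exact isGaussian_map (μ := stdGaussian E) ((innerSL ℝ w).prod (innerSL ℝ v))
  · rw [← covarianceBilin_apply_eq_cov IsGaussian.memLp_two_id, covarianceBilin_stdGaussian]
    exact h

theorem integral_inner_stdGaussian (w : E) {f : ℝ → ℝ} (hf : Measurable f) :
    ∫ x, f ⟪w, x⟫ ∂stdGaussian E = ∫ y, f (‖w‖ * y) ∂gaussianReal 0 1 := by
  rw [← integral_map (φ := fun x => ⟪w, x⟫) (by fun_prop) hf.aestronglyMeasurable,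
    stdGaussian_map_inner, integral_map (by fun_prop) hf.aestronglyMeasurable]

theorem integral_inner_inner_stdGaussian {w v : E} (h : ⟪w, v⟫ = 0) {f : ℝ × ℝ → ℝ}
    (hf : Measurable f) (c : ℝ) (hc : ∀ p, |f p| ≤ c) :
    ∫ x, f (⟪w, x⟫, ⟪v, x⟫) ∂stdGaussian E =
      ∫ s, ∫ t, f (‖w‖ * s, ‖v‖ * t) ∂gaussianReal 0 1 ∂gaussianReal 0 1 := by
  rw [← integral_map (φ := fun x => (⟪w, x⟫, ⟪v, x⟫)) (by fun_prop) hf.aestronglyMeasurable,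
    (indepFun_iff_map_prod_eq_prod_map_map (by fun_prop) (by fun_prop)).1
      (indepFun_inner_stdGaussian h), stdGaussian_map_inner, stdGaussian_map_inner,
    Measure.map_prod_map _ _ (by fun_prop) (by fun_prop),
    integral_map (by fun_prop) hf.aestronglyMeasurable,
    integral_prod _ (integrable_of_abs_le (by fun_prop) c fun p => hc _)]
  rfl

theorem integral_erf_inner (w : E) : ∫ x, erf ⟪w, x⟫ ∂stdGaussian E = 0 := by
  rw [integral_inner_stdGaussian w measurable_erf]
  simpa [erf_zero] using integral_erf_affine 0 ‖w‖

/-- The value of `E[erf(wᵀx) erf(uᵀx)]` for a standard Gaussian vector `x`. -/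
noncomputable def erfCorr (w u : E) : ℝ :=
  2 / Real.pi * Real.arcsin (2 * ⟪w, u⟫ / (√(1 + 2 * ‖u‖ ^ 2) * √(1 + 2 * ‖w‖ ^ 2)))

theorem integral_erf_mul_erf (w u : E) :
    ∫ x, erf ⟪w, x⟫ * erf ⟪u, x⟫ ∂stdGaussian E = erfCorr w u := by
  by_cases hw : w = 0
  · simp [hw, erf_zero, erfCorr]
  have hn : 0 < ‖w‖ := norm_pos_iff.2 hw
  -- Split `u` into its projection onto `w` and an orthogonal `v`. Integrating out the independent
  -- variable `⟪v, x⟫` merely rescales erf, leaving the one-dimensional correlation.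
  set ρ : ℝ := ⟪w, u⟫ / ‖w‖ ^ 2 with hρ
  set v : E := u - ρ • w with hv
  have hwv : ⟪w, v⟫ = 0 := by
    rw [hv, inner_sub_right, inner_smul_right, real_inner_self_eq_norm_sq, hρ]
    field_simp
    ring
  have hu : u = ρ • w + v := by simp [hv]
  have hnorm : ‖u‖ ^ 2 = ρ ^ 2 * ‖w‖ ^ 2 + ‖v‖ ^ 2 := by
    rw [hu, norm_add_sq_real, inner_smul_left, hwv, norm_smul, mul_pow]
    simp
  have h1 : ∀ x : E, erf ⟪w, x⟫ * erf ⟪u, x⟫ = erf ⟪w, x⟫ * erf (ρ * ⟪w, x⟫ + ⟪v, x⟫) := by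
    intro x
    rw [hu, inner_add_left, inner_smul_left]
    rfl
  simp_rw [h1]
  rw [integral_inner_inner_stdGaussian hwv
    (f := fun p : ℝ × ℝ => erf p.1 * erf (ρ * p.1 + p.2)) (by fun_prop) 1 fun p => by
    rw [abs_mul]
    exact mul_le_one₀ (abs_erf_le_one _) (abs_nonneg _) (abs_erf_le_one _)]
  have hv0 : 0 < 1 + 2 * ‖v‖ ^ 2 := by positivity
  simp_rw [integral_const_mul, integral_erf_affine]
  have h2 : ∀ s : ℝ, ρ * (‖w‖ * s) / √(1 + 2 * ‖v‖ ^ 2) =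
      (ρ * ‖w‖ / √(1 + 2 * ‖v‖ ^ 2)) * s := fun s => by ring
  simp_rw [h2]
  rw [integral_erf_mul_erf_real, erfCorr]
  have h3 : 1 + 2 * (ρ * ‖w‖ / √(1 + 2 * ‖v‖ ^ 2)) ^ 2 =
      (1 + 2 * ‖u‖ ^ 2) / (1 + 2 * ‖v‖ ^ 2) := by
    rw [hnorm, div_pow, Real.sq_sqrt hv0.le]
    field_simp
    ring
  rw [h3, Real.sqrt_div (by positivity)]
  congr 2
  have h4 : ⟪w, u⟫ = ρ * ‖w‖ ^ 2 := by rw [hρ]; field_simp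
  rw [h4]
  field_simp

end Gaussian

/-! ### The loss in closed form. -/

section Objective

variable {d : ℕ} (k : ℕ) [NeZero k]

/-- The coefficient `1 + 2·[k = 1]` of the linear term of `E[p_w p_u]` in the correlation. -/
noncomputable def linkCoeff : ℝ := if k = 1 then 3 else 1

theorem measurable_sharedPredictor (w : EuclideanSpace ℝ (Fin d)) :
    Measurable (sharedPredictor k w) := by
  unfold sharedPredictor sumPredictor prodPredictor
  refine Measurable.add (by fun_prop) (Finset.measurable_prod _ fun i _ => by fun_prop)

theorem abs_prod_erf_le_one {ι : Type*} (s : Finset ι) (f : ι → ℝ) :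
    |∏ l ∈ s, erf (f l)| ≤ 1 := by
  rw [Finset.abs_prod]
  exact Finset.prod_le_one (fun _ _ => abs_nonneg _) fun _ _ => abs_erf_le_one _

theorem abs_sharedPredictor_le (w : EuclideanSpace ℝ (Fin d))
    (x : Fin k → EuclideanSpace ℝ (Fin d)) : |sharedPredictor k w x| ≤ 2 := by
  unfold sharedPredictor sumPredictor prodPredictor
  refine (abs_add_le _ _).trans ?_
  have h1 := abs_erf_le_one ⟪w, x 0⟫
  have h2 := abs_prod_erf_le_one Finset.univ fun l => ⟪w, x l⟫
  linarith

instance : IsProbabilityMeasure (inputLaw d k) := by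
  unfold inputLaw
  infer_instance

omit [NeZero k] in
theorem integral_prod_inputLaw (f : Fin k → EuclideanSpace ℝ (Fin d) → ℝ) :
    ∫ x, ∏ l, f l (x l) ∂inputLaw d k = ∏ l, ∫ y, f l y ∂stdGaussian _ :=
  integral_fintype_prod_eq_prod f

/-- For `k ≥ 2` the product contains a factor independent of `x 0` with mean zero. For `k = 1` the
two cross terms survive, hence the value `3` in `linkCoeff`. -/
theorem integral_erf_mul_prod_erf (w u : EuclideanSpace ℝ (Fin d)) :
    ∫ x, erf ⟪w, x 0⟫ * ∏ l, erf ⟪u, x l⟫ ∂inputLaw d k =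
      if k = 1 then erfCorr w u else 0 := by
  have h : ∀ x : Fin k → EuclideanSpace ℝ (Fin d), erf ⟪w, x 0⟫ * ∏ l, erf ⟪u, x l⟫ =
      ∏ l, (if l = 0 then erf ⟪w, x l⟫ else 1) * erf ⟪u, x l⟫ := by
    intro x
    rw [Finset.prod_mul_distrib, Finset.prod_ite_eq' Finset.univ (0 : Fin k)]
    simp
  simp_rw [h]
  rw [integral_prod_inputLaw k fun l y => (if l = 0 then erf ⟪w, y⟫ else 1) * erf ⟪u, y⟫]
  split_ifs with hk
  · subst hk
    simp [integral_erf_mul_erf]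
  · have hk' : 1 < k := by have := NeZero.ne k; omega
    refine Finset.prod_eq_zero (Finset.mem_univ (⟨1, hk'⟩ : Fin k)) ?_
    have h1 : (⟨1, hk'⟩ : Fin k) ≠ 0 := by
      intro h
      have := congrArg Fin.val h
      simp at this
    simp [h1, integral_erf_inner]

theorem integral_sharedPredictor_mul (w u : EuclideanSpace ℝ (Fin d)) :
    ∫ x, sharedPredictor k w x * sharedPredictor k u x ∂inputLaw d k =
      linkCoeff k * erfCorr w u + erfCorr w u ^ k := by
  have e1 : ∫ x, erf ⟪w, x 0⟫ * erf ⟪u, x 0⟫ ∂inputLaw d k = erfCorr w u := by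
    have h := integral_prod_inputLaw k (d := d) fun l y =>
      if l = 0 then erf ⟪w, y⟫ * erf ⟪u, y⟫ else 1
    have h' : ∀ l : Fin k, ∫ y, (if l = 0 then erf ⟪w, y⟫ * erf ⟪u, y⟫ else 1)
        ∂stdGaussian (EuclideanSpace ℝ (Fin d)) = if l = 0 then erfCorr w u else 1 := by
      intro l
      split_ifs
      · exact integral_erf_mul_erf w u
      · simp
    simp_rw [h'] at h
    simpa using h
  have e4 : ∫ x, (∏ l, erf ⟪w, x l⟫) * ∏ l, erf ⟪u, x l⟫ ∂inputLaw d k = erfCorr w u ^ k := by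
    simp_rw [← Finset.prod_mul_distrib]
    rw [integral_prod_inputLaw k fun _ y => erf ⟪w, y⟫ * erf ⟪u, y⟫]
    simp [integral_erf_mul_erf]
  have hcomm : erfCorr u w = erfCorr w u := by
    rw [erfCorr, erfCorr, real_inner_comm, mul_comm (√_)]
  have e2 := integral_erf_mul_prod_erf k w u
  have e3 := integral_erf_mul_prod_erf k u w
  rw [hcomm] at e3
  have mp : ∀ w : EuclideanSpace ℝ (Fin d), Measurable
      fun x : Fin k → EuclideanSpace ℝ (Fin d) => ∏ l, erf ⟪w, x l⟫ := fun w =>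
    Finset.measurable_prod _ fun i _ => by fun_prop
  have m0 : ∀ w : EuclideanSpace ℝ (Fin d), Measurable
      fun x : Fin k → EuclideanSpace ℝ (Fin d) => erf ⟪w, x 0⟫ := fun w => by fun_prop
  have key : ∀ {f g : (Fin k → EuclideanSpace ℝ (Fin d)) → ℝ}, Measurable f → Measurable g →
      (∀ x, |f x| ≤ 1) → (∀ x, |g x| ≤ 1) → Integrable (fun x => f x * g x) (inputLaw d k) := by
    intro f g hf hg hf1 hg1
    refine integrable_of_abs_le (hf.mul hg) 1 fun x => ?_
    rw [abs_mul]
    exact mul_le_one₀ (hf1 x) (abs_nonneg _) (hg1 x)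
  have b0 : ∀ (w : EuclideanSpace ℝ (Fin d)) (x : Fin k → EuclideanSpace ℝ (Fin d)),
      |erf ⟪w, x 0⟫| ≤ 1 := fun w x => abs_erf_le_one _
  have bp : ∀ (w : EuclideanSpace ℝ (Fin d)) (x : Fin k → EuclideanSpace ℝ (Fin d)),
      |∏ l, erf ⟪w, x l⟫| ≤ 1 := fun w x => abs_prod_erf_le_one _ _
  have i1 := key (m0 w) (m0 u) (b0 w) (b0 u)
  have i2 := key (m0 w) (mp u) (b0 w) (bp u)
  have i3 := key (m0 u) (mp w) (b0 u) (bp w)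
  have i4 := key (mp w) (mp u) (bp w) (bp u)
  have hexp : ∀ x, sharedPredictor k w x * sharedPredictor k u x =
      (erf ⟪w, x 0⟫ * erf ⟪u, x 0⟫ + erf ⟪w, x 0⟫ * ∏ l, erf ⟪u, x l⟫) +
      (erf ⟪u, x 0⟫ * (∏ l, erf ⟪w, x l⟫) + (∏ l, erf ⟪w, x l⟫) * ∏ l, erf ⟪u, x l⟫) := by
    intro x
    unfold sharedPredictor sumPredictor prodPredictor
    ring
  simp_rw [hexp]
  have hsum := integral_add (i1.add i2) (i3.add i4)
  simp only [Pi.add_apply] at hsum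
  rw [hsum, integral_add i1 i2, integral_add i3 i4,
    e1, e2, e3, e4, linkCoeff]
  split_ifs <;> ring

/-- The loss in closed form. -/
theorem objective_eq (u w : EuclideanSpace ℝ (Fin d)) :
    objective k u w =
      1 / 2 * (linkCoeff k * erfCorr w w + erfCorr w w ^ k) -
        (linkCoeff k * erfCorr w u + erfCorr w u ^ k) +
        1 / 2 * (linkCoeff k * erfCorr u u + erfCorr u u ^ k) := by
  have key : ∀ w u : EuclideanSpace ℝ (Fin d),
      Integrable (fun x => sharedPredictor k w x * sharedPredictor k u x) (inputLaw d k) := by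
    intro w u
    refine integrable_of_abs_le
      ((measurable_sharedPredictor k w).mul (measurable_sharedPredictor k u)) (2 * 2) fun x => ?_
    rw [abs_mul]
    exact mul_le_mul (abs_sharedPredictor_le k w x) (abs_sharedPredictor_le k u x)
      (abs_nonneg _) (by norm_num)
  have hsum := integral_add (((key w w).const_mul (1 / 2)).sub (key w u))
    ((key u u).const_mul (1 / 2))
  simp only [Pi.sub_apply] at hsum
  rw [← integral_sharedPredictor_mul k w w, ← integral_sharedPredictor_mul k w u,
    ← integral_sharedPredictor_mul k u u, ← integral_const_mul, ← integral_const_mul,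
    ← integral_sub ((key w w).const_mul _) (key w u), ← hsum]
  unfold objective
  congr 1
  funext x
  ring

end Objective

/-! ### Gradients of the correlation and of the loss. -/

section Gradient

variable {E : Type*} [NormedAddCommGroup E] [InnerProductSpace ℝ E]

/-- The square root of the discriminant in the derivative of `erfCorr`. -/
noncomputable def corrDisc (w u : E) : ℝ :=
  √((1 + 2 * ‖u‖ ^ 2) * (1 + 2 * ‖w‖ ^ 2) - 4 * ⟪w, u⟫ ^ 2)

theorem inner_sq_le (w u : E) : ⟪w, u⟫ ^ 2 ≤ ‖u‖ ^ 2 * ‖w‖ ^ 2 := by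
  rw [← mul_pow, mul_comm]
  exact sq_le_sq' (neg_le_of_abs_le (abs_real_inner_le_norm w u)) (real_inner_le_norm w u)

/-- By Cauchy–Schwarz the discriminant is at least `1 + 2‖u‖² + 2‖w‖²`. -/
theorem sqrt_right_le_corrDisc (w u : E) : √(1 + 2 * ‖u‖ ^ 2) ≤ corrDisc w u :=
  Real.sqrt_le_sqrt (by nlinarith [inner_sq_le w u, sq_nonneg ‖w‖])

theorem corrDisc_pos (w u : E) : 0 < corrDisc w u :=
  (Real.sqrt_pos.2 (by positivity)).trans_le (sqrt_right_le_corrDisc w u)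

theorem corrDisc_le (w u : E) :
    corrDisc w u ≤ √(1 + 2 * ‖u‖ ^ 2) * √(1 + 2 * ‖w‖ ^ 2) := by
  rw [← Real.sqrt_mul (by positivity)]
  exact Real.sqrt_le_sqrt (by nlinarith [sq_nonneg ⟪w, u⟫])

theorem hasDerivAt_arcsin_ratio (w u : E) :
    HasDerivAt Real.arcsin (√(1 + 2 * ‖u‖ ^ 2) * √(1 + 2 * ‖w‖ ^ 2) / corrDisc w u)
      (2 * ⟪w, u⟫ / (√(1 + 2 * ‖u‖ ^ 2) * √(1 + 2 * ‖w‖ ^ 2))) := by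
  have hlt := abs_lt.1 (abs_ratio_lt_one (sq_nonneg ‖u‖) (sq_nonneg ‖w‖) (inner_sq_le w u))
  refine (Real.hasDerivAt_arcsin hlt.1.ne' hlt.2.ne).congr_deriv ?_
  rw [sqrt_one_sub_ratio_sq (sq_nonneg _) (sq_nonneg _), one_div_div, corrDisc]

variable [CompleteSpace E]

theorem hasGradientAt_of_comp {f : E → ℝ} {x g : E} {h : ℝ → ℝ} {h' : ℝ}
    (hh : HasDerivAt h h' (f x)) (hf : HasGradientAt f g x) :
    HasGradientAt (fun y => h (f y)) (h' • g) x := by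
  rw [hasGradientAt_iff_hasFDerivAt] at hf ⊢
  refine (hh.comp_hasFDerivAt x hf).congr_fderiv ?_
  rw [map_smul]

theorem hasGradientAt_norm_sq (w : E) : HasGradientAt (fun w : E => ‖w‖ ^ 2) ((2 : ℝ) • w) w := by
  rw [hasGradientAt_iff_hasFDerivAt]
  refine (hasStrictFDerivAt_norm_sq w).hasFDerivAt.congr_fderiv ?_
  ext y
  simp

theorem hasGradientAt_inner (u w : E) : HasGradientAt (fun w : E => ⟪w, u⟫) u w := by
  rw [hasGradientAt_iff_hasFDerivAt]
  refine (innerSL ℝ u).hasFDerivAt.congr_of_eventuallyEq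
    (Filter.Eventually.of_forall fun y => ?_)
  simp [real_inner_comm]

theorem hasGradientAt_mul {f₁ f₂ : E → ℝ} {g₁ g₂ x : E} (h₁ : HasGradientAt f₁ g₁ x)
    (h₂ : HasGradientAt f₂ g₂ x) :
    HasGradientAt (fun y => f₁ y * f₂ y) (f₁ x • g₂ + f₂ x • g₁) x := by
  rw [hasGradientAt_iff_hasFDerivAt] at h₁ h₂ ⊢
  refine (h₁.mul h₂).congr_fderiv ?_
  simp

theorem hasGradientAt_erfCorr (w u : E) :
    HasGradientAt (fun w => erfCorr w u)
      ((4 / (Real.pi * corrDisc w u)) • u -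
        (8 * ⟪w, u⟫ / (Real.pi * corrDisc w u * (1 + 2 * ‖w‖ ^ 2))) • w) w := by
  have hpi := Real.pi_pos
  have hD := corrDisc_pos w u
  have hinv := hasGradientAt_of_comp (f := fun w : E => ‖w‖ ^ 2)
    (hasDerivAt_inv_sqrt_one_add (sq_nonneg ‖w‖)) (hasGradientAt_norm_sq w)
  have hs : HasGradientAt
      (fun w => 2 * ⟪w, u⟫ / (√(1 + 2 * ‖u‖ ^ 2) * √(1 + 2 * ‖w‖ ^ 2)))
      ((2 / (√(1 + 2 * ‖u‖ ^ 2) * √(1 + 2 * ‖w‖ ^ 2))) • u -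
        (4 * ⟪w, u⟫ / (√(1 + 2 * ‖u‖ ^ 2) * ((1 + 2 * ‖w‖ ^ 2) * √(1 + 2 * ‖w‖ ^ 2)))) • w) w := by
    have h1 := hasGradientAt_of_comp (f := fun w : E => ⟪w, u⟫ * (√(1 + 2 * ‖w‖ ^ 2))⁻¹)
      ((hasDerivAt_id _).const_mul (2 / √(1 + 2 * ‖u‖ ^ 2)))
      (hasGradientAt_mul (hasGradientAt_inner u w) hinv)
    convert h1 using 1
    · funext y
      simp only [id]
      field_simp
    · simp only [smul_add, smul_smul, sub_eq_add_neg, ← neg_smul]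
      rw [add_comm]
      congr 2 <;> field_simp <;> ring
  have h2 := hasGradientAt_of_comp
    (f := fun w => 2 * ⟪w, u⟫ / (√(1 + 2 * ‖u‖ ^ 2) * √(1 + 2 * ‖w‖ ^ 2)))
    ((hasDerivAt_arcsin_ratio w u).const_mul (2 / Real.pi)) hs
  refine (congrArg (fun g => HasGradientAt (fun w => erfCorr w u) g w) ?_).mp h2
  have hB : √(1 + 2 * ‖w‖ ^ 2) * √(1 + 2 * ‖w‖ ^ 2) = 1 + 2 * ‖w‖ ^ 2 :=
    Real.mul_self_sqrt (by positivity)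
  simp only [smul_sub, smul_smul]
  congr 2 <;> field_simp <;> ring

theorem hasGradientAt_erfCorr_self (w : E) :
    HasGradientAt (fun w => erfCorr w w)
      ((8 / (Real.pi * corrDisc w w * (1 + 2 * ‖w‖ ^ 2))) • w) w := by
  have hpi := Real.pi_pos
  have hD := corrDisc_pos w w
  have hratio : ∀ w : E, 2 * ⟪w, w⟫ / (√(1 + 2 * ‖w‖ ^ 2) * √(1 + 2 * ‖w‖ ^ 2)) =
      2 * ‖w‖ ^ 2 / (1 + 2 * ‖w‖ ^ 2) := fun w => by
    rw [Real.mul_self_sqrt (by positivity), real_inner_self_eq_norm_sq]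
  have hq : HasDerivAt (fun r : ℝ => 2 * r / (1 + 2 * r)) (2 / (1 + 2 * ‖w‖ ^ 2) ^ 2)
      (‖w‖ ^ 2) := by
    refine (((hasDerivAt_id (‖w‖ ^ 2)).const_mul 2).div
      (((hasDerivAt_id (‖w‖ ^ 2)).const_mul 2).const_add 1) (by simp; positivity)).congr_deriv ?_
    simp
    field_simp
    ring
  have h1 := (hasDerivAt_arcsin_ratio w w).const_mul (2 / Real.pi)
  rw [hratio, Real.mul_self_sqrt (by positivity)] at h1
  have h2 := hasGradientAt_of_comp (f := fun w : E => 2 * ‖w‖ ^ 2 / (1 + 2 * ‖w‖ ^ 2)) h1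
    (hasGradientAt_of_comp (f := fun w : E => ‖w‖ ^ 2) hq (hasGradientAt_norm_sq w))
  have hfun : (fun w : E => erfCorr w w) = fun w =>
      2 / Real.pi * Real.arcsin (2 * ‖w‖ ^ 2 / (1 + 2 * ‖w‖ ^ 2)) := by
    funext w
    rw [erfCorr, hratio]
  rw [hfun]
  refine (congrArg (fun g => HasGradientAt _ g w) ?_).mp h2
  simp only [smul_smul]
  congr 1
  field_simp
  ring

/-- The derivative of the loss with respect to the correlation. -/
noncomputable def linkDeriv (k : ℕ) (z : ℝ) : ℝ := linkCoeff k + k * z ^ (k - 1)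

theorem hasDerivAt_link (k : ℕ) (z : ℝ) :
    HasDerivAt (fun z => linkCoeff k * z + z ^ k) (linkDeriv k z) z := by
  have h := ((hasDerivAt_id z).const_mul (linkCoeff k)).add (hasDerivAt_pow k z)
  refine h.congr_deriv ?_
  simp [linkDeriv]

/-- The unsimplified `4 * 1` and `4 * (2 * ⟪w, u⟫)` match `shrink_coeff_le` with `p = 1` and `p = 2
* ⟪w, u⟫`. -/
theorem gradient_objective {d : ℕ} (k : ℕ) [NeZero k] (u w : EuclideanSpace ℝ (Fin d)) :
    ∇ (objective k u) w =
      (linkDeriv k (erfCorr w w) * (4 * 1 / (Real.pi * corrDisc w w * (1 + 2 * ‖w‖ ^ 2))) +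
        linkDeriv k (erfCorr w u) *
          (4 * (2 * ⟪w, u⟫) / (Real.pi * corrDisc w u * (1 + 2 * ‖w‖ ^ 2)))) • w -
      (linkDeriv k (erfCorr w u) * (4 / (Real.pi * corrDisc w u))) • u := by
  have h1 := hasGradientAt_of_comp ((hasDerivAt_link k _).const_mul (1 / 2))
    (hasGradientAt_erfCorr_self w)
  have h2 := hasGradientAt_of_comp (hasDerivAt_link k _) (hasGradientAt_erfCorr w u)
  rw [hasGradientAt_iff_hasFDerivAt] at h1 h2
  have h3 := (h1.sub h2).add_const (1 / 2 * (linkCoeff k * erfCorr u u + erfCorr u u ^ k))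
  rw [← map_sub, ← hasGradientAt_iff_hasFDerivAt] at h3
  have hfun : objective k u = _ := funext (objective_eq k u)
  rw [hfun]
  refine h3.gradient.trans ?_
  match_scalars <;> ring

end Gradient

/-! ### Bounds on the step coefficients, uniform in `k`. -/

section Bounds

variable {E : Type*} [NormedAddCommGroup E] [InnerProductSpace ℝ E]

theorem one_le_linkCoeff (k : ℕ) : 1 ≤ linkCoeff k := by
  unfold linkCoeff
  split_ifs <;> norm_num

theorem linkCoeff_le (k : ℕ) : linkCoeff k ≤ 3 := by
  unfold linkCoeff
  split_ifs <;> norm_num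

theorem one_le_linkDeriv (k : ℕ) {z : ℝ} (hz : 0 ≤ z) : 1 ≤ linkDeriv k z :=
  (one_le_linkCoeff k).trans (le_add_of_nonneg_right (by positivity))

/-- Each of the `k` terms of `1 + z + ⋯ + z ^ (k - 1)` is at least `z ^ (k - 1)`. -/
theorem nat_mul_pow_le_inv_one_sub (k : ℕ) {z : ℝ} (hz : 0 ≤ z) (hz1 : z < 1) :
    k * z ^ (k - 1) ≤ 1 / (1 - z) := by
  rw [le_div_iff₀ (by linarith)]
  have h1 : (k : ℝ) * z ^ (k - 1) ≤ ∑ i ∈ Finset.range k, z ^ i := by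
    rw [← nsmul_eq_mul, ← Finset.card_range k, ← Finset.sum_const, Finset.card_range]
    refine Finset.sum_le_sum fun i hi => pow_le_pow_of_le_one hz hz1.le ?_
    have := Finset.mem_range.1 hi
    omega
  refine (mul_le_mul_of_nonneg_right h1 (by linarith)).trans ?_
  rw [geom_sum_mul_neg]
  have := pow_nonneg hz k
  linarith

theorem erfCorr_nonneg {w u : E} (h : 0 ≤ ⟪w, u⟫) : 0 ≤ erfCorr w u :=
  mul_nonneg (by have := Real.pi_pos; positivity) (Real.arcsin_nonneg.2 (by positivity))

/-- With `s` the arcsine, the ratio on the left is `cos s = sin (π/2 - s) ≤ π/2 - s`. -/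
theorem le_one_sub_erfCorr (w u : E) :
    2 / Real.pi * (corrDisc w u / (√(1 + 2 * ‖u‖ ^ 2) * √(1 + 2 * ‖w‖ ^ 2))) ≤
      1 - erfCorr w u := by
  have hpi := Real.pi_pos
  rw [corrDisc, ← sqrt_one_sub_ratio_sq (sq_nonneg _) (sq_nonneg _), ← Real.cos_arcsin,
    ← Real.sin_pi_div_two_sub, erfCorr]
  set s := Real.arcsin (2 * ⟪w, u⟫ / (√(1 + 2 * ‖u‖ ^ 2) * √(1 + 2 * ‖w‖ ^ 2)))
  have h1 : Real.sin (Real.pi / 2 - s) ≤ Real.pi / 2 - s :=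
    Real.sin_le (by linarith [show s ≤ Real.pi / 2 from Real.arcsin_le_pi_div_two _])
  calc 2 / Real.pi * Real.sin (Real.pi / 2 - s) ≤ 2 / Real.pi * (Real.pi / 2 - s) := by gcongr
    _ = 1 - 2 / Real.pi * s := by field_simp

theorem linkDeriv_le (k : ℕ) {w u : E} (h : 0 ≤ ⟪w, u⟫) :
    linkDeriv k (erfCorr w u) ≤
      3 + Real.pi / 2 * (√(1 + 2 * ‖u‖ ^ 2) * √(1 + 2 * ‖w‖ ^ 2) / corrDisc w u) := by
  have hpi := Real.pi_pos
  have hD := corrDisc_pos w u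
  have h1 := le_one_sub_erfCorr w u
  have h0 : 0 < 2 / Real.pi * (corrDisc w u / (√(1 + 2 * ‖u‖ ^ 2) * √(1 + 2 * ‖w‖ ^ 2))) := by
    positivity
  have h2 := nat_mul_pow_le_inv_one_sub k (erfCorr_nonneg h) (by linarith)
  have h3 := one_div_le_one_div_of_le h0 h1
  have h4 : 1 / (2 / Real.pi * (corrDisc w u / (√(1 + 2 * ‖u‖ ^ 2) * √(1 + 2 * ‖w‖ ^ 2)))) =
      Real.pi / 2 * (√(1 + 2 * ‖u‖ ^ 2) * √(1 + 2 * ‖w‖ ^ 2) / corrDisc w u) := by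
    field_simp
  unfold linkDeriv
  linarith [linkCoeff_le k]

/-- This is what makes the learning rate independent of `k`. With `A`, `B` the two square roots and
`D` the discriminant root, the link derivative costs a factor of order `A B / D`, but the remaining
factor is at most of order `A / (D B)`; the product is of order `(A / D)² ≤ 1`. -/
theorem shrink_coeff_le (k : ℕ) {w u : E} (h : 0 ≤ ⟪w, u⟫) {p : ℝ} (hp : 0 ≤ p)
    (hp' : p ≤ √(1 + 2 * ‖u‖ ^ 2) * √(1 + 2 * ‖w‖ ^ 2)) :
    linkDeriv k (erfCorr w u) * (4 * p / (Real.pi * corrDisc w u * (1 + 2 * ‖w‖ ^ 2))) ≤ 6 := by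
  have hpi := Real.pi_pos
  have hD := corrDisc_pos w u
  have hAD := sqrt_right_le_corrDisc w u
  have hA : 0 < √(1 + 2 * ‖u‖ ^ 2) := by positivity
  have hB : 1 ≤ √(1 + 2 * ‖w‖ ^ 2) := Real.one_le_sqrt.2 (by nlinarith [sq_nonneg ‖w‖])
  have hBB : √(1 + 2 * ‖w‖ ^ 2) ^ 2 = 1 + 2 * ‖w‖ ^ 2 := Real.sq_sqrt (by positivity)
  have hL := linkDeriv_le k h
  rw [← hBB]
  set A := √(1 + 2 * ‖u‖ ^ 2)
  set B := √(1 + 2 * ‖w‖ ^ 2)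
  set D := corrDisc w u
  have hB0 : 0 < B := by linarith
  calc _ ≤ (3 + Real.pi / 2 * (A * B / D)) * (4 * (A * B) / (Real.pi * D * B ^ 2)) := by gcongr
    _ = 12 / Real.pi * (A / D) * (1 / B) + 2 * (A / D) ^ 2 := by field_simp; ring
    _ ≤ 4 * 1 * 1 + 2 * 1 ^ 2 := by
        have h1 : A / D ≤ 1 := (div_le_one hD).2 hAD
        have h2 : 1 / B ≤ 1 := (div_le_one hB0).2 hB
        have h3 : 12 / Real.pi ≤ 4 := by
          rw [div_le_iff₀ hpi]
          linarith [Real.pi_gt_three]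
        gcongr
    _ = 6 := by norm_num

/-- A gradient step is a positive combination of the current weight and the target. -/
theorem exists_gradStep_eq {d : ℕ} (k : ℕ) [NeZero k] {η : ℝ} (hη : 0 < η) (hη' : η ≤ 1 / 24)
    {u w : EuclideanSpace ℝ (Fin d)} (h : 0 < ⟪w, u⟫) :
    ∃ a b : ℝ, 0 < a ∧ a ≤ 1 ∧
      η * (4 / (Real.pi * (√(1 + 2 * ‖u‖ ^ 2) * √(1 + 2 * ‖w‖ ^ 2)))) ≤ b ∧
      gradStep k η u w = a • w + b • u := by
  have hpi := Real.pi_pos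
  have hself : 0 ≤ ⟪w, w⟫ := real_inner_self_nonneg
  have hAB : 2 * ⟪w, u⟫ ≤ √(1 + 2 * ‖u‖ ^ 2) * √(1 + 2 * ‖w‖ ^ 2) := by
    rw [← Real.sqrt_mul (by positivity)]
    refine Real.le_sqrt_of_sq_le ?_
    nlinarith [inner_sq_le w u, sq_nonneg ‖u‖, sq_nonneg ‖w‖]
  have h1 := shrink_coeff_le k hself (p := 1) zero_le_one (by
    rw [Real.mul_self_sqrt (by positivity)]
    nlinarith [sq_nonneg ‖w‖])
  have h2 := shrink_coeff_le k h.le (p := 2 * ⟪w, u⟫) (by positivity) hAB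
  have hl1 := one_le_linkDeriv k (erfCorr_nonneg hself)
  have hl2 := one_le_linkDeriv k (erfCorr_nonneg h.le)
  have hD1 := corrDisc_pos w w
  have hD2 := corrDisc_pos w u
  have h1' : 0 ≤ linkDeriv k (erfCorr w w) *
      (4 * 1 / (Real.pi * corrDisc w w * (1 + 2 * ‖w‖ ^ 2))) :=
    mul_nonneg (by linarith) (by positivity)
  have h2' : 0 ≤ linkDeriv k (erfCorr w u) *
      (4 * (2 * ⟪w, u⟫) / (Real.pi * corrDisc w u * (1 + 2 * ‖w‖ ^ 2))) :=
    mul_nonneg (by linarith) (by positivity)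
  have hgrad := gradient_objective k u w
  set c₁ := linkDeriv k (erfCorr w w) * (4 * 1 / (Real.pi * corrDisc w w * (1 + 2 * ‖w‖ ^ 2)))
  set c₂ := linkDeriv k (erfCorr w u) *
    (4 * (2 * ⟪w, u⟫) / (Real.pi * corrDisc w u * (1 + 2 * ‖w‖ ^ 2)))
  -- Since `0 ≤ c₁, c₂ ≤ 6` and `η ≤ 1/24`, the coefficient of `w` lies in `[1/2, 1]`.
  refine ⟨1 - η * (c₁ + c₂), η * (linkDeriv k (erfCorr w u) * (4 / (Real.pi * corrDisc w u))),
    by nlinarith, by nlinarith, ?_, ?_⟩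
  · refine mul_le_mul_of_nonneg_left ?_ hη.le
    refine le_trans ?_ (le_mul_of_one_le_left (by positivity) hl2)
    gcongr
    exact corrDisc_le w u
  · rw [gradStep, hgrad]
    module

end Bounds

/-! ### Geometry of sequences pulled towards a target. -/

section Angle

variable {E : Type*} [NormedAddCommGroup E] [InnerProductSpace ℝ E]

/-- The cosine increases: bound the new norm by the triangle inequality and use `⟪w, u⟫ ≤ ‖w‖ ‖u‖`.
-/
theorem angle_smul_add_smul_le {u w : E} (h : 0 < ⟪w, u⟫) {a b : ℝ} (ha : 0 < a) (hb : 0 ≤ b) :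
    InnerProductGeometry.angle u (a • w + b • u) ≤ InnerProductGeometry.angle u w := by
  have hu : 0 < ‖u‖ := norm_pos_iff.2 (by rintro rfl; simp at h)
  have hw : 0 < ‖w‖ := norm_pos_iff.2 (by rintro rfl; simp at h)
  have hin : ⟪u, a • w + b • u⟫ = a * ⟪w, u⟫ + b * ‖u‖ ^ 2 := by
    rw [inner_add_right, inner_smul_right, inner_smul_right, real_inner_self_eq_norm_sq,
      real_inner_comm]
  have hpos : 0 < ⟪u, a • w + b • u⟫ := by rw [hin]; positivity
  have hn : 0 < ‖a • w + b • u‖ := norm_pos_iff.2 (by intro h0; simp [h0] at hpos)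
  have hle : ‖a • w + b • u‖ ≤ a * ‖w‖ + b * ‖u‖ := by
    refine (norm_add_le _ _).trans_eq ?_
    rw [norm_smul, norm_smul, Real.norm_of_nonneg ha.le, Real.norm_of_nonneg hb]
  refine Real.arccos_le_arccos ?_
  rw [div_le_div_iff₀ (by positivity) (by positivity), hin, real_inner_comm]
  have h1 := real_inner_le_norm w u
  calc ⟪w, u⟫ * (‖u‖ * ‖a • w + b • u‖)
      ≤ ⟪w, u⟫ * (‖u‖ * (a * ‖w‖ + b * ‖u‖)) := by gcongr
    _ = a * ⟪w, u⟫ * (‖u‖ * ‖w‖) + b * ‖u‖ ^ 2 * ⟪w, u⟫ := by ring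
    _ ≤ a * ⟪w, u⟫ * (‖u‖ * ‖w‖) + b * ‖u‖ ^ 2 * (‖w‖ * ‖u‖) := by gcongr
    _ = (a * ⟪w, u⟫ + b * ‖u‖ ^ 2) * (‖u‖ * ‖w‖) := by ring

/-- The right-hand side is the tangent of the angle, which dominates the angle. -/
theorem angle_le_norm_div {u v : E} (hu : u ≠ 0) (huv : ⟪u, v⟫ = 0) {p : ℝ} (hp : 0 < p) :
    InnerProductGeometry.angle u (p • u + v) ≤ ‖v‖ / (p * ‖u‖) := by
  have horth : ⟪p • u, v⟫ = 0 := by rw [inner_smul_left, huv, mul_zero]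
  have hpu : p • u ≠ 0 := smul_ne_zero hp.ne' hu
  rw [← InnerProductGeometry.angle_smul_left_of_pos _ _ hp]
  refine (Real.le_tan (InnerProductGeometry.angle_nonneg _ _)
    (InnerProductGeometry.angle_add_lt_pi_div_two_of_inner_eq_zero horth hpu)).trans_eq ?_
  rw [InnerProductGeometry.tan_angle_add_of_inner_eq_zero horth, norm_smul,
    Real.norm_of_nonneg hp.le]

/-- A sequence in the ball of radius `‖u‖` that is pulled towards `u` at relative rate at least
`κ` has a component along `u` that dominates the orthogonal one linearly in time. -/
theorem exists_orthogonal_decomposition {u : E} {w : ℕ → E} {κ : ℝ} (hκ : 0 ≤ κ)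
    (h0 : 0 < ⟪w 0, u⟫) (hw : ∀ t, ‖w t‖ ≤ ‖u‖)
    (hstep : ∀ t, 0 < ⟪w t, u⟫ →
      ∃ a b : ℝ, 0 < a ∧ κ * a ≤ b ∧ w (t + 1) = a • w t + b • u) (t : ℕ) :
    ∃ (p : ℝ) (v : E), w t = p • u + v ∧ ⟪u, v⟫ = 0 ∧ 0 < p ∧ t * κ * ‖v‖ ≤ p * ‖u‖ := by
  have hu : 0 < ‖u‖ := norm_pos_iff.2 (by intro hu; simp [hu] at h0)
  induction t with
  | zero =>
    refine ⟨⟪w 0, u⟫ / ‖u‖ ^ 2, w 0 - (⟪w 0, u⟫ / ‖u‖ ^ 2) • u, by simp, ?_, by positivity, ?_⟩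
    · rw [inner_sub_right, inner_smul_right, real_inner_self_eq_norm_sq, real_inner_comm]
      field_simp
      ring
    · simp only [Nat.cast_zero, zero_mul]
      positivity
  | succ t ih =>
    obtain ⟨p, v, hpv, huv, hp, hle⟩ := ih
    have hin : 0 < ⟪w t, u⟫ := by
      rw [hpv, inner_add_left, inner_smul_left, real_inner_comm u v, huv,
        real_inner_self_eq_norm_sq, add_zero]
      exact mul_pos hp (by positivity)
    obtain ⟨a, b, ha, hb, hab⟩ := hstep t hin
    have hb0 : 0 ≤ b := (mul_nonneg hκ ha.le).trans hb
    -- By Pythagoras `‖v‖ ≤ ‖w t‖`; this turns the gain `b‖u‖` into at least `κ a ‖v‖`.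
    have hv : ‖v‖ ≤ ‖u‖ := by
      refine le_trans ?_ (hw t)
      have h1 := norm_add_sq_eq_norm_sq_add_norm_sq_of_inner_eq_zero (p • u) v
        (by rw [inner_smul_left, huv, mul_zero])
      rw [← hpv] at h1
      exact abs_le_of_sq_le_sq' (by nlinarith [mul_self_nonneg ‖p • u‖]) (norm_nonneg _) |>.2
    refine ⟨a * p + b, a • v, ?_, ?_, by positivity, ?_⟩
    · rw [hab, hpv]
      module
    · rw [inner_smul_right, huv, mul_zero]
    · rw [norm_smul, Real.norm_of_nonneg ha.le]
      push_cast
      calc (t + 1) * κ * (a * ‖v‖) = a * (t * κ * ‖v‖) + κ * a * ‖v‖ := by ring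
        _ ≤ a * (p * ‖u‖) + b * ‖u‖ := by gcongr
        _ = (a * p + b) * ‖u‖ := by ring

end Angle

/-! ### One step of either algorithm, with its rate. -/

theorem exists_pos_projBall_eq {d : ℕ} {r : ℝ} (hr : 0 < r) (v : EuclideanSpace ℝ (Fin d)) :
    ∃ c : ℝ, 0 < c ∧ projBall r v = c • v := by
  unfold projBall
  split_ifs with h
  · exact ⟨1, one_pos, (one_smul _ _).symm⟩
  · exact ⟨r / ‖v‖, div_pos hr (hr.trans (not_le.1 h)), rfl⟩

theorem rate_le {k : ℕ} (hk : 1 ≤ k) {A B : ℝ} (hA : A ^ 2 = 12 / Real.pi ^ 2 * (k : ℝ) ^ 2)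
    (hB : 0 ≤ B) (hBA : B ≤ A) :
    1 / (5 * (k : ℝ) ^ 2) ≤ 4 / (Real.pi * (√(1 + 2 * A ^ 2) * √(1 + 2 * B ^ 2))) := by
  have hpi := Real.pi_gt_three
  have hpi' := Real.pi_lt_four
  have hk' : (1 : ℝ) ≤ (k : ℝ) := by exact_mod_cast hk
  have h1 : √(1 + 2 * A ^ 2) * √(1 + 2 * B ^ 2) ≤ 1 + 2 * A ^ 2 := by
    calc √(1 + 2 * A ^ 2) * √(1 + 2 * B ^ 2) ≤ √(1 + 2 * A ^ 2) * √(1 + 2 * A ^ 2) := by gcongr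
      _ = 1 + 2 * A ^ 2 := Real.mul_self_sqrt (by positivity)
  rw [div_le_div_iff₀ (by positivity) (by positivity), one_mul]
  have h2 : Real.pi * A ^ 2 ≤ 4 * (k : ℝ) ^ 2 := by
    rw [hA, show Real.pi * (12 / Real.pi ^ 2 * (k : ℝ) ^ 2) = 12 / Real.pi * (k : ℝ) ^ 2 by
      field_simp]
    gcongr
    rw [div_le_iff₀ (by linarith)]
    linarith
  calc Real.pi * (√(1 + 2 * A ^ 2) * √(1 + 2 * B ^ 2)) ≤ Real.pi * (1 + 2 * A ^ 2) := by gcongr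
    _ ≤ 4 * (5 * (k : ℝ) ^ 2) := by nlinarith

theorem exists_step {d k : ℕ} [NeZero k] {η : ℝ} (hη : 0 < η) (hη' : η ≤ 1 / 24)
    {u : EuclideanSpace ℝ (Fin d)} {w : ℕ → EuclideanSpace ℝ (Fin d)}
    (hu : ‖u‖ ^ 2 = 12 / Real.pi ^ 2 * (k : ℝ) ^ 2) (hw : ∀ t, ‖w t‖ ≤ ‖u‖)
    (hrun : IsGD k η u w ∨ IsProjectedGD k η u w) (t : ℕ) (h : 0 < ⟪w t, u⟫) :
    ∃ a b : ℝ, 0 < a ∧ η / (5 * (k : ℝ) ^ 2) * a ≤ b ∧ w (t + 1) = a • w t + b • u := by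
  have hk : 1 ≤ k := NeZero.one_le
  have hu0 : 0 < ‖u‖ := norm_pos_iff.2 (by rintro rfl; simp at h)
  obtain ⟨a, b, ha, ha1, hb, hab⟩ := exists_gradStep_eq k hη hη' h
  have hrate := mul_le_mul_of_nonneg_left (rate_le hk hu (norm_nonneg _) (hw t)) hη.le
  have hb' : η / (5 * (k : ℝ) ^ 2) * a ≤ b := by
    refine (mul_le_of_le_one_right (by positivity) ha1).trans (le_trans ?_ hb)
    rwa [div_eq_mul_one_div]
  -- Projection onto a centred ball is a positive rescaling, so it preserves the ratio of `b` to
  -- `a`.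
  obtain ⟨c, hc, hwc⟩ : ∃ c : ℝ, 0 < c ∧ w (t + 1) = c • gradStep k η u (w t) := by
    rcases hrun with hrun | hrun
    · exact ⟨1, one_pos, by rw [hrun t, one_smul]⟩
    · rw [hrun t]
      exact exists_pos_projBall_eq hu0 _
  refine ⟨c * a, c * b, by positivity, ?_, ?_⟩
  · rw [mul_left_comm]
    gcongr
  · rw [hwc, hab]
    module

end WeightSharing

/-! ### Conclusion and iteration count. -/

open WeightSharing in
theorem mainTheorem5 :
    ∃ η₀ : ℝ, 0 < η₀ ∧ ∃ C : ℝ, 0 < C ∧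
      ∀ (η : ℝ), 0 < η → η ≤ η₀ →
      ∀ (d k : ℕ) [NeZero k] (u₀ : EuclideanSpace ℝ (Fin d))
        (w : ℕ → EuclideanSpace ℝ (Fin d)),
        ‖u₀‖ ^ 2 = 12 / Real.pi ^ 2 * (k : ℝ) ^ 2 →
        0 < inner ℝ (w 0) u₀ →
        (∀ t, ‖w t‖ ≤ ‖u₀‖) →
        (WeightSharing.IsGD k η u₀ w ∨ WeightSharing.IsProjectedGD k η u₀ w) →
        (∀ t, InnerProductGeometry.angle u₀ (w (t + 1)) ≤ InnerProductGeometry.angle u₀ (w t)) ∧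
        ∀ ε : ℝ, 0 < ε →
          ∃ T : ℕ, (T : ℝ) ≤ C / η * ((k : ℝ) / ε) ^ 3 ∧
            InnerProductGeometry.angle u₀ (w T) < ε := by
  refine ⟨1 / 24, by norm_num, 21, by norm_num, ?_⟩
  intro η hη hη' d k _ u w hu h0 hw hrun
  have hu0 : u ≠ 0 := by rintro rfl; simp at h0
  have hun : 0 < ‖u‖ := norm_pos_iff.2 hu0
  have hk : (1 : ℝ) ≤ (k : ℝ) := by exact_mod_cast NeZero.one_le (n := k)
  have hstep := exists_step hη hη' hu hw hrun
  have hκ : 0 < η / (5 * (k : ℝ) ^ 2) := by positivity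
  have hdec := exists_orthogonal_decomposition hκ.le h0 hw hstep
  have hpos : ∀ t, 0 < ⟪w t, u⟫ := by
    intro t
    obtain ⟨p, v, hpv, huv, hp, -⟩ := hdec t
    rw [hpv, inner_add_left, inner_smul_left, real_inner_comm u v, huv,
      real_inner_self_eq_norm_sq, add_zero]
    exact mul_pos hp (by positivity)
  refine ⟨fun t => ?_, fun ε hε => ?_⟩
  · obtain ⟨a, b, ha, hb, hab⟩ := hstep t (hpos t)
    rw [hab]
    exact angle_smul_add_smul_le (hpos t) ha ((mul_nonneg hκ.le ha.le).trans hb)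
  -- For large `ε` the bound on `T` may be below `1`, so `T = 0` is taken; the threshold `2` exceeds
  -- `π/2`.
  · rcases le_or_gt 2 ε with h2 | h2
    · refine ⟨0, by simp only [Nat.cast_zero]; positivity, ?_⟩
      have h1 : InnerProductGeometry.angle u (w 0) ≤ Real.pi / 2 := by
        rw [InnerProductGeometry.angle, Real.arccos_le_pi_div_two]
        have := hpos 0
        rw [real_inner_comm] at this
        positivity
      linarith [Real.pi_lt_d2]
    · set κ := η / (5 * (k : ℝ) ^ 2) with hκ_def
      -- The least `T` with `T κ ε > 1`.
      refine ⟨⌊1 / (κ * ε)⌋₊ + 1, ?_, ?_⟩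
      · have h1 : ((⌊1 / (κ * ε)⌋₊ : ℕ) : ℝ) ≤ 1 / (κ * ε) := Nat.floor_le (by positivity)
        have h3 : 1 / (κ * ε) = 5 / η * ((k : ℝ) ^ 2 / ε) := by
          rw [hκ_def]
          field_simp
        have hx : 1 / 2 ≤ (k : ℝ) / ε := by
          rw [div_le_div_iff₀ two_pos hε]
          linarith
        -- As `ε² < 4 ≤ 4k`, `k² / ε` is at most `4 (k/ε)³`. The factor `5` from `κ` gives `20`, and
        -- the rounding `+ 1` is absorbed by one more unit, hence `21`.
        have h4 : (k : ℝ) ^ 2 / ε ≤ 2 * ((k : ℝ) / ε) ^ 3 * 2 := by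
          have h5 : ε ^ 2 ≤ 4 * k := by nlinarith
          rw [div_pow, div_le_iff₀ hε]
          have h6 : 2 * ((k : ℝ) ^ 3 / ε ^ 3) * 2 * ε = k ^ 2 * (4 * k / ε ^ 2) := by
            field_simp
            ring
          rw [h6]
          exact le_mul_of_one_le_right (by positivity) ((one_le_div (by positivity)).2 h5)
        have h7 : (1 / 2 : ℝ) ^ 3 ≤ ((k : ℝ) / ε) ^ 3 := by gcongr
        have h8 : 1 ≤ 1 / η * ((k : ℝ) / ε) ^ 3 := by
          rw [div_mul_eq_mul_div, one_mul, one_le_div hη]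
          linarith
        push_cast
        calc _ ≤ 5 / η * (2 * ((k : ℝ) / ε) ^ 3 * 2) + 1 / η * ((k : ℝ) / ε) ^ 3 := by
              refine add_le_add (h1.trans (h3.trans_le ?_)) h8
              gcongr
          _ = 21 / η * ((k : ℝ) / ε) ^ 3 := by ring
      · obtain ⟨p, v, hpv, huv, hp, hle⟩ := hdec (⌊1 / (κ * ε)⌋₊ + 1)
        have hT : 1 / (κ * ε) < ((⌊1 / (κ * ε)⌋₊ + 1 : ℕ) : ℝ) := by
          push_cast
          exact Nat.lt_floor_add_one _
        rw [hpv]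
        refine (angle_le_norm_div hu0 huv hp).trans_lt ?_
        rw [div_lt_iff₀ (by positivity)]
        generalize ((⌊1 / (κ * ε)⌋₊ + 1 : ℕ) : ℝ) = T at hT hle
        rw [div_lt_iff₀ (by positivity)] at hT
        -- Strictness comes from `T κ ε > 1` only if `v ≠ 0`; otherwise the left side is zero.
        rcases (norm_nonneg v).eq_or_lt with hv | hv
        · rw [← hv]
          positivity
        · calc ‖v‖ < ‖v‖ * (T * (κ * ε)) := lt_mul_of_one_lt_right hv hT
            _ = ε * (T * κ * ‖v‖) := by ring
            _ ≤ ε * (p * ‖u‖) := by gcongr
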